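/- Let $F$ be a finitely generated non-abelian free group. A function $\alpha:F\to\mathbb R$ is a quasimorphism if $|\alpha(gh)-\alpha(g)-\alpha(h)|$ is bounded uniformly in $g,h\in F$; it is homogeneous if $\alpha(g^n)=n\,\alpha(g)$ for all $g\in F$, $n\in\mathbb N$. Let $\mathcal H(F)$ be the real vector space of homogeneous quasimorphisms on $F$, with the topology of pointwise convergence; $\mathrm{Out}(F)$ acts on it by $[f]^*\alpha=\alpha\circ f$. Every quasimorphism $\alpha$ is at bounded distance from a unique $\widehat\alpha\in\mathcal H(F)$, its homogenization. For a free generating set (free basis) $S$ of $F$ and a reduced word $w_0$ over $S\cup S^{-1}$, let $\#_{w_0}(w)$ be the number of (possibly overlapping) occurrences of $w_0$ as a contiguous subword of the reduced word $w$, and let $\phi_{w_0}:F\to\mathbb Z$, $\phi_{w_0}(g)=\#_{w_0}(w_g)-\#_{w_0^{-1}}(w_g)$, where $w_g$ is the reduced word over $S\cup S^{-1}$ representing $g$. This is a quasimorphism, the overlapping counting quasimorphism of $w_0$. Let $\mathcal H^*(F,S)\subseteq\mathcal H(F)$ be the linear span of the homogenizations $\widehat{\phi_{w_0}}$ over all reduced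 words $w_0$ over $S\cup S^{-1}$. Then: (i) $\mathcal H^*(F,S)$ is invariant under the action of $\mathrm{Out}(F)$, and it is independent of the choice of $S$: $\mathcal H^*(F,S)=\mathcal H^*(F,S')$ for all free generating sets $S,S'$ of $F$. (ii) $\mathcal H^*(F):=\mathcal H^*(F,S)$ is dense in $\mathcal H(F)$ with respect to the topology of pointwise convergence. (iii) $\mathcal H^*(F)$ has countably infinite dimension $\aleph_0$. -/

import Mathlib

open Filter Topology

/-! ### Quasimorphisms and homogeneous quasimorphisms -/

section Quasimorphisms

variable {G : Type*} [Group G]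

/-- `α : G → ℝ` is a quasimorphism: `|α (gh) - α g - α h|` is bounded uniformly in `g, h`. -/
def IsQuasimorphism (α : G → ℝ) : Prop :=
  ∃ D : ℝ, ∀ g h : G, |α (g * h) - α g - α h| ≤ D

/-- `α (g ^ n) = n * α g` for all `g` and all natural numbers `n`. -/
def IsHomogeneousFun (α : G → ℝ) : Prop :=
  ∀ (g : G) (n : ℕ), α (g ^ n) = n * α g

/-- Two functions are equivalent if their difference is bounded. -/
def BddEquiv (α β : G → ℝ) : Prop :=
  ∃ C : ℝ, ∀ g : G, |α g - β g| ≤ C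

variable (G) in
/-- The real vector space `Q(G)` of real-valued quasimorphisms on `G`. -/
def quasimorphisms : Submodule ℝ (G → ℝ) where
  carrier := {α | IsQuasimorphism α}
  zero_mem' := ⟨0, by simp⟩
  add_mem' := by
    rintro α β ⟨D, hD⟩ ⟨E, hE⟩
    refine ⟨D + E, fun g h => ?_⟩
    have h1 := hD g h
    have h2 := hE g h
    simp only [Pi.add_apply]
    rw [abs_le] at *
    constructor <;> linarith [h1.1, h1.2, h2.1, h2.2]
  smul_mem' := by
    rintro c α ⟨D, hD⟩
    refine ⟨|c| * D, fun g h => ?_⟩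
    have : (c • α) (g * h) - (c • α) g - (c • α) h = c * (α (g * h) - α g - α h) := by
      simp only [Pi.smul_apply, smul_eq_mul]; ring
    rw [this, abs_mul]
    exact mul_le_mul_of_nonneg_left (hD g h) (abs_nonneg c)

variable (G) in
/-- The real vector space `H(G)` of homogeneous quasimorphisms on `G`. As a subspace of `G → ℝ`
(with the product topology) it carries the topology of pointwise convergence. -/
def homogeneousQuasimorphisms : Submodule ℝ (G → ℝ) where
  carrier := {α | IsQuasimorphism α ∧ IsHomogeneousFun α}
  zero_mem' := ⟨(quasimorphisms G).zero_mem, fun g n => by simp⟩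
  add_mem' := by
    rintro α β ⟨hα, hα'⟩ ⟨hβ, hβ'⟩
    refine ⟨(quasimorphisms G).add_mem hα hβ, fun g n => ?_⟩
    simp only [Pi.add_apply, hα' g n, hβ' g n]; ring
  smul_mem' := by
    rintro c α ⟨hα, hα'⟩
    refine ⟨(quasimorphisms G).smul_mem c hα, fun g n => ?_⟩
    simp only [Pi.smul_apply, smul_eq_mul, hα' g n]; ring

theorem eq_zero_of_forall_nat_mul_le {x C : ℝ} (h : ∀ n : ℕ, (n : ℝ) * |x| ≤ C) : x = 0 := by
  by_contra hx
  have hx' : 0 < |x| := abs_pos.mpr hx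
  obtain ⟨n, hn⟩ := exists_nat_gt (C / |x|)
  have := h n
  rw [div_lt_iff₀ hx'] at hn
  linarith

/-- Equivalent homogeneous functions are equal. -/
theorem BddEquiv.eq_of_homogeneous {α β : G → ℝ} (hα : IsHomogeneousFun α)
    (hβ : IsHomogeneousFun β) (h : BddEquiv α β) : α = β := by
  obtain ⟨C, hC⟩ := h
  funext g
  refine sub_eq_zero.mp (eq_zero_of_forall_nat_mul_le (C := C) fun n => ?_)
  have := hC (g ^ n)
  rwa [hα, hβ, ← mul_sub, abs_mul, Nat.abs_cast] at this

theorem IsQuasimorphism.of_bddEquiv {α β : G → ℝ} (hα : IsQuasimorphism α)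
    (h : BddEquiv α β) : IsQuasimorphism β := by
  obtain ⟨D, hD⟩ := hα
  obtain ⟨C, hC⟩ := h
  refine ⟨D + 3 * C, fun g h => ?_⟩
  have h0 := hD g h
  have h1 := hC (g * h)
  have h2 := hC g
  have h3 := hC h
  rw [abs_le] at *
  constructor <;> linarith [h0.1, h0.2, h1.1, h1.2, h2.1, h2.2, h3.1, h3.2]

theorem abs_pow_sub_le {α : G → ℝ} {D : ℝ} (hD : ∀ g h : G, |α (g * h) - α g - α h| ≤ D)
    (g : G) (n : ℕ) : |α (g ^ n) - n * α g| ≤ (n + 1) * D := by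
  induction n with
  | zero =>
    have := hD 1 1
    simp only [mul_one, sub_self, zero_sub, abs_neg] at this
    simpa using this
  | succ n ih =>
    have h1 := hD (g ^ n) g
    rw [← pow_succ] at h1
    push_cast
    rw [abs_le] at *
    constructor <;> linarith [h1.1, h1.2, ih.1, ih.2]

/-- Every quasimorphism is equivalent to a unique homogeneous quasimorphism. -/
theorem existsUnique_homogenization (α : quasimorphisms G) :
    ∃! β : homogeneousQuasimorphisms G, BddEquiv (α : G → ℝ) (β : G → ℝ) := by
  obtain ⟨α, hα⟩ := α
  obtain ⟨D, hD⟩ := id hα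
  have hpow := abs_pow_sub_le hD
  have hD0 : 0 ≤ D := (abs_nonneg _).trans (hD 1 1)
  have hlim : ∀ g : G, ∃ l : ℝ, Tendsto (fun n : ℕ => α (g ^ n) / n) atTop (𝓝 l) := by
    intro g
    have hsub : Subadditive (fun n : ℕ => α (g ^ n) + D) := by
      intro m n
      have := (abs_le.mp (hD (g ^ m) (g ^ n))).2
      rw [← pow_add] at this
      linarith
    have hbdd : BddBelow (Set.range fun n : ℕ => (α (g ^ n) + D) / n) := by
      refine ⟨-|α g| - D, ?_⟩
      rintro _ ⟨n, rfl⟩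
      rcases Nat.eq_zero_or_pos n with rfl | hn
      · simp only [Nat.cast_zero, div_zero]
        linarith [abs_nonneg (α g)]
      · have hn' : (0 : ℝ) < n := by exact_mod_cast hn
        have h1 := (abs_le.mp (hpow g n)).1
        have h2 := neg_abs_le (α g)
        simp only
        rw [le_div_iff₀ hn']
        nlinarith
    have h1 := hsub.tendsto_lim hbdd
    have h2 : Tendsto (fun n : ℕ => D / (n : ℝ)) atTop (𝓝 0) :=
      tendsto_const_div_atTop_nhds_zero_nat D
    refine ⟨hsub.lim, ?_⟩
    have h3 := h1.sub h2
    rw [sub_zero] at h3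
    refine h3.congr fun n => ?_
    ring
  choose β hβ using hlim
  have hequiv : BddEquiv α β := by
    refine ⟨2 * D, fun g => ?_⟩
    have h1 : Tendsto (fun n : ℕ => |α g - α (g ^ n) / n|) atTop (𝓝 |α g - β g|) :=
      (tendsto_const_nhds.sub (hβ g)).abs
    refine le_of_tendsto h1 ?_
    filter_upwards [eventually_ge_atTop 1] with n hn
    have hn' : (1 : ℝ) ≤ n := by exact_mod_cast hn
    have hn0 : (0 : ℝ) < n := by linarith
    have h2 := hpow g n
    have h3 : α g - α (g ^ n) / n = -(α (g ^ n) - n * α g) / n := by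
      field_simp; ring
    rw [h3, abs_div, abs_neg, abs_of_pos hn0, div_le_iff₀ hn0]
    nlinarith
  have hhom : IsHomogeneousFun β := by
    intro g k
    rcases Nat.eq_zero_or_pos k with rfl | hk
    · have h1 : Tendsto (fun n : ℕ => α 1 / (n : ℝ)) atTop (𝓝 0) :=
        tendsto_const_div_atTop_nhds_zero_nat _
      have h2 := hβ 1
      simp only [one_pow] at h2
      simp [tendsto_nhds_unique h2 h1]
    · have hk' : (k : ℝ) ≠ 0 := by exact_mod_cast hk.ne'
      have h1 : Tendsto (fun n : ℕ => (k : ℝ) * (α (g ^ (k * n)) / ((k * n : ℕ) : ℝ))) atTop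
          (𝓝 (k * β g)) :=
        ((hβ g).comp (tendsto_id.const_mul_atTop' hk)).const_mul _
      refine tendsto_nhds_unique (hβ (g ^ k)) (h1.congr fun n => ?_)
      rw [pow_mul, Nat.cast_mul]
      rcases Nat.eq_zero_or_pos n with rfl | hn
      · simp
      · have : (n : ℝ) ≠ 0 := by exact_mod_cast hn.ne'
        field_simp
  refine ⟨⟨β, IsQuasimorphism.of_bddEquiv hα hequiv, hhom⟩, hequiv, ?_⟩
  rintro ⟨γ, hγ, hγ'⟩ ⟨C, hC⟩
  obtain ⟨C', hC'⟩ := hequiv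
  refine Subtype.ext (BddEquiv.eq_of_homogeneous hγ' hhom ⟨C + C', fun g => ?_⟩)
  have h1 := hC g
  have h2 := hC' g
  simp only at h1 h2 ⊢
  rw [abs_le] at *
  constructor <;> linarith [h1.1, h1.2, h2.1, h2.2]

/-- The homogenization of a quasimorphism: the unique homogeneous quasimorphism
at bounded distance from it. -/
noncomputable def homogenization (α : quasimorphisms G) : homogeneousQuasimorphisms G :=
  (existsUnique_homogenization α).choose

/-! ### The outer automorphism group and its action on `H(G)` -/

variable (G) in
/-- The subgroup of inner automorphisms of `G`. -/
def innerAut : Subgroup (MulAut G) := (MulAut.conj : G →* MulAut G).range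

instance innerAut_normal : (innerAut G).Normal where
  conj_mem := by
    rintro _ ⟨g, rfl⟩ f
    refine ⟨f g, ?_⟩
    ext x
    simp [MulAut.conj_apply]

variable (G) in
/-- The outer automorphism group `Out(G)`. -/
abbrev OuterAut : Type _ := MulAut G ⧸ innerAut G

/-- The pullback `f^* α = α ∘ f` of homogeneous quasimorphisms under an automorphism `f`. -/
def autPullback (f : MulAut G) :
    homogeneousQuasimorphisms G →ₗ[ℝ] homogeneousQuasimorphisms G where
  toFun α := ⟨fun g => (α : G → ℝ) (f g), by
    obtain ⟨α, ⟨D, hD⟩, hα⟩ := α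
    refine ⟨⟨D, fun g h => ?_⟩, fun g n => ?_⟩
    · simpa only [map_mul] using hD (f g) (f h)
    · simpa only [map_pow] using hα (f g) n⟩
  map_add' _ _ := rfl
  map_smul' _ _ := rfl

/-- Pullback, as a right action of `Aut(G)` on `H(G)`. -/
def autPullbackHom : MulAut G →* (Module.End ℝ (homogeneousQuasimorphisms G))ᵐᵒᵖ where
  toFun f := MulOpposite.op (autPullback f)
  map_one' := rfl
  map_mul' _ _ := rfl

/-- Homogeneous quasimorphisms are invariant under conjugation. -/
theorem homogeneous_conj {α : G → ℝ} (hq : IsQuasimorphism α) (hh : IsHomogeneousFun α)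
    (g x : G) : α (g * x * g⁻¹) = α x := by
  obtain ⟨D, hD⟩ := hq
  refine sub_eq_zero.mp
    (eq_zero_of_forall_nat_mul_le (C := 2 * D + |α g + α g⁻¹|) fun n => ?_)
  have h1 := hD (g * x ^ n) g⁻¹
  have h2 := hD g (x ^ n)
  have h3 : α (g * x ^ n * g⁻¹) = n * α (g * x * g⁻¹) := by rw [← hh, conj_pow]
  have h4 := hh x n
  have h5 : (n : ℝ) * |α (g * x * g⁻¹) - α x| = |α (g * x ^ n * g⁻¹) - α (x ^ n)| := by
    rw [h3, h4, ← mul_sub, abs_mul, Nat.abs_cast]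
  rw [h5]
  have h6 := abs_le.mp (le_refl |α g + α g⁻¹|)
  rw [abs_le] at h1 h2
  rw [abs_le]
  constructor <;> linarith [h1.1, h1.2, h2.1, h2.2, h6.1, h6.2]

/-- The right action `[f]^* α = α ∘ f` of `Out(G)` on `H(G)`. -/
def outPullback : OuterAut G →* (Module.End ℝ (homogeneousQuasimorphisms G))ᵐᵒᵖ :=
  QuotientGroup.lift (innerAut G) autPullbackHom (by
    rintro _ ⟨g, rfl⟩
    refine MulOpposite.unop_injective (LinearMap.ext fun α => Subtype.ext (funext fun x => ?_))
    exact homogeneous_conj α.2.1 α.2.2 g x)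

end Quasimorphisms

/-! ### Overlapping counting quasimorphisms -/

section Counting

/-- The number of (possibly overlapping) occurrences of `w₀` as a contiguous subword of `w`,
counted by their starting positions. -/
noncomputable def countSubword {A : Type*} (w₀ w : List A) : ℕ :=
  open Classical in ((Finset.range (w.length + 1)).filter fun j => w₀ <+: w.drop j).card

/-- The map `w ↦ #_{w₀}(w) - #_{w₀⁻¹}(w)` on words over `S ∪ S⁻¹`. A letter `s` is encoded
as `(s, true)`, its inverse as `(s, false)`. -/
noncomputable def countingOnWords {ι : Type*} (w₀ w : List (ι × Bool)) : ℤ :=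
  (countSubword w₀ w : ℤ) - (countSubword (FreeGroup.invRev w₀) w : ℤ)

/-- The reduced word over `S ∪ S⁻¹` representing `g`. -/
noncomputable def FreeGroupBasis.reducedWord {ι F : Type*} [Group F] (S : FreeGroupBasis ι F)
    (g : F) : List (ι × Bool) :=
  open Classical in (S.repr g).toWord

/-- The overlapping counting function `φ_{w₀}` on `F` with respect to the free basis `S`. -/
noncomputable def countingFun {ι F : Type*} [Group F] (S : FreeGroupBasis ι F)
    (w₀ : List (ι × Bool)) (g : F) : ℤ :=
  countingOnWords w₀ (S.reducedWord g)

open Classical in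
theorem countSubword_nil {A : Type*} (w₀ : List A) :
    countSubword w₀ [] = if w₀ = [] then 1 else 0 := by
  unfold countSubword
  by_cases h : w₀ = [] <;> simp [h]

open Classical in
theorem countSubword_cons {A : Type*} (w₀ : List A) (a : A) (w : List A) :
    countSubword w₀ (a :: w) = (if w₀ <+: a :: w then 1 else 0) + countSubword w₀ w := by
  unfold countSubword
  rw [Finset.card_filter, Finset.card_filter, List.length_cons, Finset.sum_range_succ', add_comm]
  simp

open Classical in
theorem countSubword_append {A : Type*} (w₀ u v : List A) :
    |(countSubword w₀ (u ++ v) : ℤ) - countSubword w₀ u - countSubword w₀ v|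
      ≤ (min u.length w₀.length : ℕ) + 1 := by
  induction u with
  | nil =>
    rw [countSubword_nil]
    split_ifs <;> simp
  | cons a u ih =>
    rw [List.cons_append, countSubword_cons, countSubword_cons]
    by_cases h : w₀.length ≤ (a :: u).length
    · have hiff : w₀ <+: a :: (u ++ v) ↔ w₀ <+: a :: u := by
        rw [← List.cons_append]
        constructor
        · intro h'
          exact List.prefix_of_prefix_length_le h' (List.prefix_append _ _) h
        · intro h'
          exact h'.trans (List.prefix_append _ _)
      have hmin : min u.length w₀.length ≤ min (a :: u).length w₀.length := by
        simp only [List.length_cons]; omega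
      have hmin' : ((min u.length w₀.length : ℕ) : ℤ) ≤ (min (a :: u).length w₀.length : ℕ) := by
        exact_mod_cast hmin
      simp only [hiff]
      push_cast at *
      rw [abs_le] at *
      constructor <;> linarith [ih.1, ih.2]
    · have hmin : min (a :: u).length w₀.length = min u.length w₀.length + 1 := by
        simp only [List.length_cons] at *; omega
      have hno : ¬ w₀ <+: a :: u := fun h' => h h'.length_le
      rw [hmin, if_neg hno]
      rw [abs_le] at *
      push_cast at *
      split_ifs <;> constructor <;> linarith [ih.1, ih.2]

theorem countSubword_invRev {ι : Type*} (w₀ w : List (ι × Bool)) :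
    countSubword (FreeGroup.invRev w₀) (FreeGroup.invRev w) = countSubword w₀ w := by
  have key : ∀ w₀ w : List (ι × Bool), countSubword w₀ w ≤
      countSubword (FreeGroup.invRev w₀) (FreeGroup.invRev w) := by
    intro w₀ w
    classical
    unfold countSubword
    refine Finset.card_le_card_of_injOn (fun j => w.length - w₀.length - j) ?_ ?_
    · intro j hj
      simp only [Finset.coe_filter, Finset.mem_range, Set.mem_ofPred_eq] at hj ⊢
      obtain ⟨hj, t, ht⟩ := hj
      have hw : w = w.take j ++ (w₀ ++ t) := by rw [ht, List.take_append_drop]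
      have hlen : w.length - w₀.length - j = t.length := by
        have := congrArg List.length ht
        simp only [List.length_append, List.length_drop] at this
        omega
      refine ⟨by rw [FreeGroup.invRev_length]; omega, FreeGroup.invRev (w.take j), ?_⟩
      rw [hlen]
      conv_rhs => rw [hw]
      rw [FreeGroup.invRev_append, FreeGroup.invRev_append, List.append_assoc,
        List.drop_append_of_le_length (by simp),
        List.drop_of_length_le (by simp), List.nil_append]
    · intro i hi j hj hij
      simp only [Finset.coe_filter, Finset.mem_range, Set.mem_ofPred_eq] at hi hj hij
      have h1 := hi.2.length_le
      have h2 := hj.2.length_le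
      simp only [List.length_drop] at h1 h2
      omega
  refine le_antisymm ?_ (key w₀ w)
  simpa using key (FreeGroup.invRev w₀) (FreeGroup.invRev w)

theorem countingOnWords_invRev {ι : Type*} (w₀ w : List (ι × Bool)) :
    countingOnWords w₀ (FreeGroup.invRev w) = -countingOnWords w₀ w := by
  have h1 := countSubword_invRev w₀ w
  have h2 := countSubword_invRev (FreeGroup.invRev w₀) w
  rw [FreeGroup.invRev_invRev] at h2
  unfold countingOnWords
  rw [h1, h2]
  ring

theorem countingOnWords_append {ι : Type*} (w₀ u v : List (ι × Bool)) :
    |countingOnWords w₀ (u ++ v) - countingOnWords w₀ u - countingOnWords w₀ v|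
      ≤ 2 * w₀.length + 2 := by
  have h1 := countSubword_append w₀ u v
  have h2 := countSubword_append (FreeGroup.invRev w₀) u v
  rw [FreeGroup.invRev_length] at h2
  have h3 : ((min u.length w₀.length : ℕ) : ℤ) ≤ w₀.length := by
    exact_mod_cast min_le_right _ _
  unfold countingOnWords
  rw [abs_le] at *
  constructor <;> linarith [h1.1, h1.2, h2.1, h2.2]

/-- The cancellation in a product of two reduced words. -/
theorem exists_cancellation {ι : Type*} [DecidableEq ι] (u : List (ι × Bool)) :
    ∀ v : List (ι × Bool), FreeGroup.IsReduced u → FreeGroup.IsReduced v →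
      ∃ a c b, u = a ++ c ∧ v = FreeGroup.invRev c ++ b ∧ FreeGroup.reduce (u ++ v) = a ++ b := by
  induction u using List.reverseRecOn with
  | nil =>
    intro v _ hv
    exact ⟨[], [], v, by simp, by simp, by simpa using hv.reduce_eq⟩
  | append_singleton u x ih =>
    intro v hu hv
    cases v with
    | nil => exact ⟨u ++ [x], [], [], by simp, by simp, by simpa using hu.reduce_eq⟩
    | cons y v =>
      by_cases hxy : x.1 = y.1 → x.2 = y.2
      · refine ⟨u ++ [x], [], y :: v, by simp, by simp, ?_⟩
        have h := hu.append_overlap (L₃ := y :: v)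
          (List.isChain_cons_cons.mpr ⟨hxy, hv⟩) (by simp)
        exact h.reduce_eq
      · push Not at hxy
        obtain ⟨a, c, b, rfl, rfl, h⟩ := ih v (hu.infix (List.prefix_append _ _).isInfix)
          (hv.infix (List.suffix_cons _ _).isInfix)
        have hy : y = (x.1, !x.2) := by
          refine Prod.ext hxy.1.symm ?_
          have := hxy.2
          revert this
          cases x.2 <;> cases y.2 <;> simp
        refine ⟨a, c ++ [x], b, by simp, by simp [hy, FreeGroup.invRev], ?_⟩
        rw [← h, hy]
        refine FreeGroup.reduce.Step.eq ?_
        have := FreeGroup.Red.Step.not (L₁ := a ++ c) (L₂ := FreeGroup.invRev c ++ b)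
          (x := x.1) (b := x.2)
        simpa using this

/-- Counting functions are quasimorphisms. -/
theorem isQuasimorphism_countingFun {ι F : Type*} [Group F] (S : FreeGroupBasis ι F)
    (w₀ : List (ι × Bool)) : IsQuasimorphism fun g : F => (countingFun S w₀ g : ℝ) := by
  classical
  refine ⟨((3 * (2 * w₀.length + 2) : ℤ) : ℝ), fun g h => ?_⟩
  obtain ⟨a, c, b, hg, hh, hgh⟩ := exists_cancellation (S.reducedWord g) (S.reducedWord h)
    FreeGroup.isReduced_toWord FreeGroup.isReduced_toWord
  have hmul : S.reducedWord (g * h) = a ++ b := by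
    rw [← hgh]
    unfold FreeGroupBasis.reducedWord
    rw [map_mul, FreeGroup.toWord_mul]
  have h1 := countingOnWords_append w₀ a b
  have h2 := countingOnWords_append w₀ a c
  have h3 := countingOnWords_append w₀ (FreeGroup.invRev c) b
  rw [countingOnWords_invRev] at h3
  have : |countingFun S w₀ (g * h) - countingFun S w₀ g - countingFun S w₀ h|
      ≤ 3 * (2 * w₀.length + 2) := by
    unfold countingFun
    rw [hmul, hg, hh]
    rw [abs_le] at *
    constructor <;> linarith [h1.1, h1.2, h2.1, h2.2, h3.1, h3.2]
  simp only
  exact_mod_cast this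

/-- The overlapping counting quasimorphism `φ_{w₀}` as an element of `Q(F)`. -/
noncomputable def countingQuasimorphism {ι F : Type*} [Group F] (S : FreeGroupBasis ι F)
    (w₀ : List (ι × Bool)) : quasimorphisms F :=
  ⟨fun g => (countingFun S w₀ g : ℝ), isQuasimorphism_countingFun S w₀⟩

/-- The space `H^*(F, S)`: the span in `H(F)` of the homogenizations of the overlapping counting
quasimorphisms `φ_{w₀}`, where `w₀` ranges over the reduced words over `S ∪ S⁻¹`. -/
noncomputable def hocSpan {ι F : Type*} [Group F] (S : FreeGroupBasis ι F) :
    Submodule ℝ (homogeneousQuasimorphisms F) :=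
  Submodule.span ℝ {β | ∃ w₀ : List (ι × Bool), FreeGroup.IsReduced w₀ ∧
    β = homogenization (countingQuasimorphism S w₀)}

end Counting

/-!
# The span of the counting quasimorphisms of a free group

For words over a finite alphabet, a `windowSum` is a weighted count of the subwords of a fixed
length `M`, that is, a sum of a function over all windows of length `M`. A homogeneous quasimorphism
at bounded distance from a window sum of the `S`-reduced word lies in `hocSpan S`: it is odd, and
the odd part of a subword count is half of a counting quasimorphism
(`mem_hocSpan_of_bddEquiv_windowSum`). All four claims are then reduced to window sums.

*Independence of the basis.* A function of words is a window sum up to a bounded error as soon as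
its increment on prepending a letter depends only on the first `N` letters
(`exists_windowSum_of_local`). The number of occurrences of `w` in the `T`-reduced word of `g` has
this property as a function of the `S`-reduced word of `g`: left multiplication by `a` changes the
count by an amount that depends only on an initial piece of the `T`-word of `g`
(`countSubword_reducedWord_mul`), and this piece is determined by an initial piece of the `S`-word
(`exists_take_reducedWord_eq`), because the two word lengths are bi-Lipschitz equivalent. So
counting quasimorphisms over `T` lie in `hocSpan S`. Invariance under `Out(F)` follows, since
pulling back along an automorphism turns counting over `S` into counting over a translated basis.

*Density.* Let `α` be a homogeneous quasimorphism of defect `D`. Summing `α` over the windows of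
length `M` of the reduced word of `g` gives `M * α g` with an error at most `D * |g| + C`, where only
`C` depends on `M` (`exists_abs_windowSum_sub_le`). Evaluating on powers of `g` removes `C`, so the
homogenizations of the normalized window sums are within `D * |g| / M` of `α` at `g`
(`exists_mem_hocSpan_abs_sub_le`).

*Dimension.* There are countably many words. For two letters `a ≠ b` of the basis, the homogenized
counting quasimorphism of `a bⁿ a` takes the value `1` on `a bᵐ` if `n = m` and `0` otherwise.
-/

/-! ### Counting subwords -/

section Words

variable {A : Type*}

/-- Lengthening a word to the left changes its subword counts by an amount that depends only on
the prolongation and on an initial piece of the word at least as long as the counted subword. -/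
theorem countSubword_append_append (w u b s : List A) (hb : w.length ≤ b.length) :
    countSubword w (u ++ (b ++ s)) + countSubword w b =
      countSubword w (u ++ b) + countSubword w (b ++ s) := by
  classical
  induction u with
  | nil => simp [add_comm]
  | cons x u ih =>
    have hiff : w <+: x :: (u ++ (b ++ s)) ↔ w <+: x :: (u ++ b) := by
      have e : x :: (u ++ (b ++ s)) = (x :: (u ++ b)) ++ s := by simp
      rw [e]
      refine ⟨fun h => List.prefix_of_prefix_length_le h (List.prefix_append _ _) ?_,
        fun h => h.trans (List.prefix_append _ _)⟩
      simp only [List.length_cons, List.length_append]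
      omega
    rw [List.cons_append, List.cons_append, countSubword_cons, countSubword_cons]
    simp only [hiff]
    omega

theorem countSubword_eq_zero_of_not_infix {w l : List A} (h : ¬ w <:+: l) :
    countSubword w l = 0 := by
  classical
  induction l with
  | nil =>
    rw [countSubword_nil, if_neg]
    rintro rfl
    exact h (List.nil_infix)
  | cons x l ih =>
    rw [countSubword_cons, if_neg fun h' => h h'.isInfix,
      ih fun h' => h (h'.trans (List.suffix_cons x l).isInfix)]

variable [Finite A]

/-- The words of length `M` over a finite alphabet. -/
noncomputable def wordsOfLength (A : Type*) [Finite A] (M : ℕ) : Finset (List A) :=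
  (List.finite_length_eq A M).toFinset

theorem mem_wordsOfLength {M : ℕ} {v : List A} : v ∈ wordsOfLength A M ↔ v.length = M := by
  simp [wordsOfLength]

/-- The number of occurrences in `l` of the words of length `M`, weighted by `θ`; that is, the sum
of the values of `θ` over all windows of length `M` of the word `l`. -/
noncomputable def windowSum (M : ℕ) (θ : List A → ℝ) (l : List A) : ℝ :=
  ∑ v ∈ wordsOfLength A M, θ v * countSubword v l

theorem windowSum_of_length_lt {M : ℕ} (θ : List A → ℝ) {l : List A} (h : l.length < M) :
    windowSum M θ l = 0 := by
  refine Finset.sum_eq_zero fun v hv => ?_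
  rw [mem_wordsOfLength] at hv
  rw [countSubword_eq_zero_of_not_infix fun h' => ?_, Nat.cast_zero, mul_zero]
  exact absurd h'.length_le (by omega)

theorem windowSum_cons {M : ℕ} (θ : List A → ℝ) {x : A} {l : List A}
    (h : M ≤ (x :: l).length) :
    windowSum M θ (x :: l) = θ ((x :: l).take M) + windowSum M θ l := by
  classical
  have hsum : ∑ v ∈ wordsOfLength A M, (if v = (x :: l).take M then θ v else 0) =
      θ ((x :: l).take M) := by
    rw [Finset.sum_ite_eq' _ _ θ, if_pos]
    rw [mem_wordsOfLength, List.length_take, min_eq_left h]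
  rw [windowSum, windowSum, ← hsum, ← Finset.sum_add_distrib]
  refine Finset.sum_congr rfl fun v hv => ?_
  rw [mem_wordsOfLength] at hv
  have hiff : v <+: x :: l ↔ v = (x :: l).take M := by rw [List.prefix_iff_eq_take, hv]
  rw [countSubword_cons]
  simp only [hiff]
  split_ifs <;> push_cast <;> ring

theorem exists_bound_of_length_le (ψ : List A → ℝ) (M : ℕ) :
    ∃ B : ℝ, ∀ v : List A, v.length ≤ M → |ψ v| ≤ B := by
  have h := (List.finite_length_le A M).image fun v => |ψ v|
  obtain ⟨B, hB⟩ := h.bddAbove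
  exact ⟨B, fun v hv => hB ⟨v, hv, rfl⟩⟩

/-- A function on a suffix-closed set of words whose increment on prepending a letter depends only
on the first `N` letters of the result is a weighted sum over windows, up to a bounded error. -/
theorem exists_windowSum_of_local (p : List A → Prop) (hp : ∀ x l, p (x :: l) → p l)
    (h : List A → ℝ) (N : ℕ)
    (hloc : ∀ x l x' l', p (x :: l) → p (x' :: l') → N ≤ (x :: l).length →
      N ≤ (x' :: l').length → (x :: l).take N = (x' :: l').take N →
      h (x :: l) - h l = h (x' :: l') - h l') :
    ∃ θ : List A → ℝ, ∃ C : ℝ, ∀ l, p l → |h l - windowSum N θ l| ≤ C := by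
  classical
  have hθ : ∃ θ : List A → ℝ, ∀ x l, p (x :: l) → N ≤ (x :: l).length →
      h (x :: l) - h l = θ ((x :: l).take N) := by
    refine ⟨fun v => if hv : ∃ q : A × List A, p (q.1 :: q.2) ∧ N ≤ (q.1 :: q.2).length ∧
      (q.1 :: q.2).take N = v then h (hv.choose.1 :: hv.choose.2) - h hv.choose.2 else 0,
      fun x l hl hN => ?_⟩
    have hv : ∃ q : A × List A, p (q.1 :: q.2) ∧ N ≤ (q.1 :: q.2).length ∧
      (q.1 :: q.2).take N = (x :: l).take N := ⟨(x, l), hl, hN, rfl⟩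
    beta_reduce
    rw [dif_pos hv]
    exact hloc _ _ _ _ hl hv.choose_spec.1 hN hv.choose_spec.2.1 hv.choose_spec.2.2.symm
  obtain ⟨θ, hθ⟩ := hθ
  obtain ⟨C, hC⟩ := exists_bound_of_length_le (fun l => h l - windowSum N θ l) N
  refine ⟨θ, C, fun l hl => ?_⟩
  induction l with
  | nil => exact hC [] (Nat.zero_le _)
  | cons x l ih =>
    rcases le_or_gt N (x :: l).length with hN | hN
    · have := hθ x l hl hN
      rw [windowSum_cons θ hN, ← this]
      have h1 := ih (hp x l hl)
      rwa [show h (x :: l) - (h (x :: l) - h l + windowSum N θ l) = h l - windowSum N θ l by ring]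
    · exact hC _ hN.le

/-- For a quasimorphism `ψ` on words, summing `ψ` over the windows of length `M` approximates
`M * ψ` with an error whose growth rate `D` does not depend on `M`. Both quantities are compared
with the potential `P l = ∑ j < M, ψ (l.drop j)`: removing the first letter of `l` changes `P` by
`ψ l - ψ (l.drop M)`, which is `ψ` of the first window up to `D`. -/
theorem exists_abs_windowSum_sub_le {ψ : List A → ℝ} {D : ℝ}
    (hD : ∀ u v, |ψ (u ++ v) - ψ u - ψ v| ≤ D) {M : ℕ} (hM : 0 < M) :
    ∃ C : ℝ, ∀ l, |windowSum M ψ l - M * ψ l| ≤ D * l.length + C := by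
  obtain ⟨B, hB⟩ := exists_bound_of_length_le ψ M
  have hD0 : 0 ≤ D := (abs_nonneg _).trans (hD [] [])
  have h1 : ∀ l, |windowSum M ψ l - ∑ j ∈ Finset.range M, ψ (l.drop j)| ≤
      D * l.length + M * B := by
    intro l
    have hshort : ∀ l : List A, l.length < M →
        |windowSum M ψ l - ∑ j ∈ Finset.range M, ψ (l.drop j)| ≤ D * l.length + M * B := by
      intro l hl
      rw [windowSum_of_length_lt ψ hl, zero_sub, abs_neg]
      have h2 : |∑ j ∈ Finset.range M, ψ (l.drop j)| ≤ M * B := by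
        refine (Finset.abs_sum_le_sum_abs _ _).trans ?_
        refine (Finset.sum_le_card_nsmul _ _ B fun j _ => hB _ ?_).trans
          (by rw [Finset.card_range, nsmul_eq_mul])
        rw [List.length_drop]
        omega
      have h3 : 0 ≤ D * l.length := by positivity
      linarith
    induction l with
    | nil => exact hshort [] hM
    | cons x l ih =>
      rcases le_or_gt M (x :: l).length with hN | hN
      · obtain ⟨m, rfl⟩ : ∃ m, M = m + 1 := ⟨M - 1, by omega⟩
        rw [windowSum_cons ψ hN, Finset.sum_range_succ']
        rw [Finset.sum_range_succ] at ih
        have h2 := hD ((x :: l).take (m + 1)) ((x :: l).drop (m + 1))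
        rw [List.take_append_drop] at h2
        simp only [List.drop_succ_cons, List.drop_zero, List.length_cons] at h2 ⊢
        push_cast at ih ⊢
        rw [abs_le] at *
        constructor <;> linarith [h2.1, h2.2, ih.1, ih.2]
      · exact hshort _ hN
  refine ⟨M * B + M * (D + B), fun l => ?_⟩
  have h2 : |∑ j ∈ Finset.range M, ψ (l.drop j) - M * ψ l| ≤ M * (D + B) := by
    have : ∑ j ∈ Finset.range M, ψ (l.drop j) - M * ψ l =
        ∑ j ∈ Finset.range M, (ψ (l.drop j) - ψ l) := by
      rw [Finset.sum_sub_distrib]; simp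
    rw [this]
    refine (Finset.abs_sum_le_sum_abs _ _).trans ?_
    refine (Finset.sum_le_card_nsmul _ _ (D + B) fun j hj => ?_).trans
      (by rw [Finset.card_range, nsmul_eq_mul])
    have h3 := hD (l.take j) (l.drop j)
    rw [List.take_append_drop] at h3
    have h4 := hB (l.take j) (by
      rw [List.length_take]; have := Finset.mem_range.mp hj; omega)
    rw [abs_le] at *
    constructor <;> linarith [h3.1, h3.2, h4.1, h4.2]
  have h3 := h1 l
  rw [abs_le] at *
  constructor <;> linarith [h2.1, h2.2, h3.1, h3.2]

end Words

/-! ### Reduced words with respect to a free basis -/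

namespace FreeGroupBasis

variable {ι κ F : Type*} [Group F] (S : FreeGroupBasis ι F) (T : FreeGroupBasis κ F)

/-- The element of `F` that is spelled by a (not necessarily reduced) word over `S ∪ S⁻¹`. -/
def ofWord (l : List (ι × Bool)) : F :=
  S.repr.symm (FreeGroup.mk l)

theorem ofWord_append (u v : List (ι × Bool)) : S.ofWord (u ++ v) = S.ofWord u * S.ofWord v := by
  rw [ofWord, ← FreeGroup.mul_mk, map_mul, ofWord, ofWord]

theorem isReduced_reducedWord (g : F) : FreeGroup.IsReduced (S.reducedWord g) := by
  classical exact FreeGroup.isReduced_toWord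

theorem ofWord_reducedWord (g : F) : S.ofWord (S.reducedWord g) = g := by
  classical simp [ofWord, reducedWord, FreeGroup.mk_toWord]

theorem reducedWord_ofWord {l : List (ι × Bool)} (hl : FreeGroup.IsReduced l) :
    S.reducedWord (S.ofWord l) = l := by
  classical
  rw [ofWord, reducedWord, MulEquiv.apply_symm_apply, FreeGroup.toWord_mk, hl.reduce_eq]

theorem reducedWord_one : S.reducedWord 1 = [] := by
  classical simp [reducedWord]

theorem reducedWord_inv (g : F) : S.reducedWord g⁻¹ = FreeGroup.invRev (S.reducedWord g) := by
  classical rw [reducedWord, map_inv, FreeGroup.toWord_inv, reducedWord]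

theorem length_reducedWord_inv (g : F) :
    (S.reducedWord g⁻¹).length = (S.reducedWord g).length := by
  rw [reducedWord_inv, FreeGroup.invRev_length]

theorem length_reducedWord_mul_le (g h : F) :
    (S.reducedWord (g * h)).length ≤ (S.reducedWord g).length + (S.reducedWord h).length := by
  classical
  have := FreeGroup.norm_mul_le (S.repr g) (S.repr h)
  rwa [← map_mul] at this

theorem length_reducedWord_pow_le (g : F) (n : ℕ) :
    (S.reducedWord (g ^ n)).length ≤ n * (S.reducedWord g).length := by
  induction n with
  | zero => simp [reducedWord_one]
  | succ n ih =>
    rw [pow_succ, Nat.succ_mul]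
    exact (S.length_reducedWord_mul_le _ _).trans (by omega)

/-- The cancellation in the product of two elements of `F`. -/
theorem exists_reducedWord_mul (g h : F) : ∃ a c b, S.reducedWord g = a ++ c ∧
    S.reducedWord h = FreeGroup.invRev c ++ b ∧ S.reducedWord (g * h) = a ++ b := by
  classical
  obtain ⟨a, c, b, h1, h2, h3⟩ := exists_cancellation (S.reducedWord g) (S.reducedWord h)
    (S.isReduced_reducedWord g) (S.isReduced_reducedWord h)
  refine ⟨a, c, b, h1, h2, ?_⟩
  rw [← h3, reducedWord, map_mul, FreeGroup.toWord_mul]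
  rfl

/-- A finitely generated free group has only finitely many homomorphisms to `ℤ/2`, while those
homomorphisms correspond to the maps from a basis to `ℤ/2`. -/
theorem finite_of_fg (S : FreeGroupBasis ι F) [Group.FG F] : Finite ι := by
  obtain ⟨α, _, φ, hφ⟩ := Group.fg_iff_exists_freeGroup_hom_surjective_finite.mp ‹Group.FG F›
  let M := Multiplicative (ZMod 2)
  have hinj : Function.Injective fun f : ι → M => fun a => S.lift f (φ (FreeGroup.of a)) := by
    intro f f' hff
    refine S.lift.injective (MonoidHom.cancel_right hφ |>.mp ?_)
    ext a
    exact congrFun hff a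
  have : Finite (ι → M) := Finite.of_injective _ hinj
  by_contra h
  rw [not_finite_iff_infinite] at h
  exact not_finite (ι → M)

theorem exists_ne_of_not_comm (S : FreeGroupBasis ι F) (hF : ∃ a b : F, a * b ≠ b * a) :
    ∃ i j : ι, i ≠ j := by
  by_contra! h
  obtain ⟨a, b, hab⟩ := hF
  have hcl : ∀ x : FreeGroup ι, ∀ i, Commute x (FreeGroup.of i) := by
    intro x i
    induction x using FreeGroup.induction_on with
    | C1 => exact Commute.one_left _
    | of j => rw [h i j]
    | inv_of j hj => exact hj.inv_left
    | mul x y hx hy => exact hx.mul_left hy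
  have hcomm : ∀ x y : FreeGroup ι, Commute x y := by
    intro x y
    induction y using FreeGroup.induction_on with
    | C1 => exact Commute.one_right _
    | of j => exact hcl x j
    | inv_of j hj => exact hj.inv_right
    | mul x y hx hy => exact hx.mul_right hy
  refine hab (S.repr.injective ?_)
  rw [map_mul, map_mul]
  exact hcomm _ _

/-! ### Comparing reduced words over two free bases -/

theorem exists_bound_length_ofWord_singleton [Finite ι] :
    ∃ L : ℕ, ∀ x : ι × Bool, (T.reducedWord (S.ofWord [x])).length ≤ L := by
  obtain ⟨L, hL⟩ := (Set.finite_range fun x : ι × Bool =>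
    (T.reducedWord (S.ofWord [x])).length).bddAbove
  exact ⟨L, fun x => hL ⟨x, rfl⟩⟩

theorem exists_length_reducedWord_le [Finite ι] :
    ∃ L : ℕ, ∀ g : F, (T.reducedWord g).length ≤ L * (S.reducedWord g).length := by
  obtain ⟨L, hL⟩ := S.exists_bound_length_ofWord_singleton T
  have key : ∀ l, (T.reducedWord (S.ofWord l)).length ≤ L * l.length := by
    intro l
    induction l with
    | nil =>
      have : S.ofWord [] = 1 := by
        rw [ofWord, ← FreeGroup.one_eq_mk, map_one]
      simp [this, reducedWord_one]
    | cons x l ih =>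
      rw [← List.singleton_append, ofWord_append]
      refine (T.length_reducedWord_mul_le _ _).trans ?_
      have := hL x
      rw [List.length_append, List.length_singleton, mul_add, mul_one]
      omega
  refine ⟨L, fun g => ?_⟩
  have := key (S.reducedWord g)
  rwa [ofWord_reducedWord] at this

theorem take_reducedWord_mul {K : ℕ} {g z : F}
    (h : K + (S.reducedWord z).length ≤ (S.reducedWord g).length) :
    (S.reducedWord (g * z)).take K = (S.reducedWord g).take K := by
  obtain ⟨a, c, b, h1, h2, h3⟩ := S.exists_reducedWord_mul g z
  rw [h1, h2] at h
  simp only [List.length_append, FreeGroup.invRev_length] at h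
  rw [h3, h1, List.take_append_of_le_length (by omega), List.take_append_of_le_length (by omega)]

/-- Long initial pieces of the `S`-reduced word of `g` determine the initial piece of length `K` of
its `T`-reduced word. Reading the `S`-word beyond its first `N` letters multiplies by elements of
bounded `T`-length, while the `T`-length of the element read so far stays large, so that the first
`K` letters never change. -/
theorem exists_take_reducedWord_eq [Finite ι] [Finite κ] (K : ℕ) :
    ∃ N : ℕ, ∀ l : List (ι × Bool), FreeGroup.IsReduced l → N ≤ l.length →
      (T.reducedWord (S.ofWord l)).take K = (T.reducedWord (S.ofWord (l.take N))).take K := by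
  obtain ⟨L, hL⟩ := S.exists_bound_length_ofWord_singleton T
  obtain ⟨L', hL'⟩ := T.exists_length_reducedWord_le S
  refine ⟨(L' + 1) * (K + L), fun l hl hN => ?_⟩
  induction l using List.reverseRecOn with
  | nil => simp
  | append_singleton l x ih =>
    rcases hN.eq_or_lt with hN | hN
    · rw [hN, List.take_length]
    · rw [List.length_append, List.length_singleton] at hN
      have hl' : FreeGroup.IsReduced l := hl.infix (List.prefix_append _ _).isInfix
      rw [List.take_append_of_le_length (by omega), ← ih hl' (by omega), ofWord_append]
      refine T.take_reducedWord_mul ?_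
      have h1 := hL' (S.ofWord l)
      rw [S.reducedWord_ofWord hl'] at h1
      have h2 : K + L ≤ (T.reducedWord (S.ofWord l)).length := by
        refine le_of_mul_le_mul_left (a := L' + 1) ?_ (Nat.succ_pos _)
        rw [Nat.succ_mul L' (List.length _)]
        omega
      have := hL x
      omega

/-- The change of the number of occurrences of `w` under left multiplication by `a` depends only
on an initial piece of the reduced word. -/
theorem countSubword_reducedWord_mul (w : List (ι × Bool)) (a g g' : F)
    (h : (S.reducedWord g).take ((S.reducedWord a).length + w.length + 1) =
      (S.reducedWord g').take ((S.reducedWord a).length + w.length + 1)) :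
    countSubword w (S.reducedWord (a * g)) + countSubword w (S.reducedWord g') =
      countSubword w (S.reducedWord (a * g')) + countSubword w (S.reducedWord g) := by
  set K := (S.reducedWord a).length + w.length + 1 with hK
  rcases lt_or_ge (S.reducedWord g).length K with hlt | hge
  · have hgg : S.reducedWord g = S.reducedWord g' := by
      rw [List.take_of_length_le hlt.le] at h
      rw [h, List.take_eq_self_iff]
      by_contra! hc
      have := congrArg List.length h
      rw [List.length_take, min_eq_left hc.le] at this
      omega
    rw [← S.ofWord_reducedWord g, hgg, S.ofWord_reducedWord g']
  · set r := (S.reducedWord g).take K with hr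
    have hrlen : r.length = K := by rw [hr, List.length_take, min_eq_left hge]
    have hred : FreeGroup.IsReduced r :=
      (S.isReduced_reducedWord g).infix (List.take_prefix _ _).isInfix
    obtain ⟨p, c, b, h1, h2, h3⟩ := S.exists_reducedWord_mul a (S.ofWord r)
    rw [S.reducedWord_ofWord hred] at h2
    have hb : w.length + 1 ≤ b.length := by
      have e1 := congrArg List.length h1
      have e2 := congrArg List.length h2
      simp only [List.length_append, FreeGroup.invRev_length] at e1 e2
      omega
    have key : ∀ x : F, (S.reducedWord x).take K = r → ∃ s,
        S.reducedWord x = FreeGroup.invRev c ++ (b ++ s) ∧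
          S.reducedWord (a * x) = p ++ (b ++ s) := by
      intro x hx
      have hxs : S.reducedWord x = FreeGroup.invRev c ++ (b ++ (S.reducedWord x).drop K) := by
        rw [← List.append_assoc, ← h2, ← hx, List.take_append_drop]
      refine ⟨(S.reducedWord x).drop K, hxs, ?_⟩
      have hpb : FreeGroup.IsReduced (p ++ b) := h3 ▸ S.isReduced_reducedWord _
      have hbs : FreeGroup.IsReduced (b ++ (S.reducedWord x).drop K) := by
        have := S.isReduced_reducedWord x
        rw [hxs] at this
        exact this.infix (List.suffix_append _ _).isInfix
      have hpbs := hpb.append_overlap hbs (List.ne_nil_of_length_pos (by omega))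
      rw [List.append_assoc] at hpbs
      have e : a * x = S.ofWord (p ++ (b ++ (S.reducedWord x).drop K)) := by
        rw [← List.append_assoc, ofWord_append, ← h3, ofWord_reducedWord, mul_assoc,
          ← ofWord_append, ← hx, List.take_append_drop, ofWord_reducedWord]
      rw [e, S.reducedWord_ofWord hpbs]
    obtain ⟨s, hs1, hs2⟩ := key g rfl
    obtain ⟨s', hs1', hs2'⟩ := key g' h.symm
    have e1 := countSubword_append_append w p b s (by omega)
    have e2 := countSubword_append_append w (FreeGroup.invRev c) b s (by omega)
    have e3 := countSubword_append_append w p b s' (by omega)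
    have e4 := countSubword_append_append w (FreeGroup.invRev c) b s' (by omega)
    rw [hs1, hs2, hs1', hs2']
    omega

end FreeGroupBasis

/-! ### Homogenization -/

section Homogenization

variable {G : Type*} [Group G]

theorem bddEquiv_homogenization (α : quasimorphisms G) :
    BddEquiv (α : G → ℝ) (homogenization α : G → ℝ) :=
  (existsUnique_homogenization α).choose_spec.1

theorem eq_homogenization {α : quasimorphisms G} {β : homogeneousQuasimorphisms G}
    (h : BddEquiv (α : G → ℝ) (β : G → ℝ)) : β = homogenization α :=
  (existsUnique_homogenization α).unique h (bddEquiv_homogenization α)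

theorem le_of_forall_nat_mul_le_add {x y C : ℝ} (h : ∀ n : ℕ, n * x ≤ n * y + C) : x ≤ y := by
  by_contra! hxy
  have hpos : 0 < x - y := sub_pos.mpr hxy
  obtain ⟨n, hn⟩ := exists_nat_gt (C / (x - y))
  rw [div_lt_iff₀ hpos] at hn
  linarith [h n]

theorem IsHomogeneousFun.map_one {α : G → ℝ} (hh : IsHomogeneousFun α) : α 1 = 0 := by
  simpa using hh 1 0

theorem homogeneous_inv {α : G → ℝ} (hq : IsQuasimorphism α) (hh : IsHomogeneousFun α) (g : G) :
    α g⁻¹ = -α g := by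
  obtain ⟨D, hD⟩ := hq
  refine eq_neg_of_add_eq_zero_left (eq_zero_of_forall_nat_mul_le (C := D) fun n => ?_)
  have h1 := hD (g⁻¹ ^ n) (g ^ n)
  rwa [← (Commute.refl g).inv_left.mul_pow, inv_mul_cancel, one_pow, hh.map_one, hh, hh,
    zero_sub, ← neg_add', ← mul_add, abs_neg, abs_mul, Nat.abs_cast] at h1

end Homogenization

/-! ### Window sums and the span of the counting quasimorphisms -/

section Span

variable {ι κ F : Type*} [Group F]

theorem countingFun_eq (S : FreeGroupBasis ι F) (v : List (ι × Bool)) (g : F) :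
    countingFun S v g =
      (countSubword v (S.reducedWord g) : ℤ) - countSubword v (S.reducedWord g⁻¹) := by
  have h := countSubword_invRev (FreeGroup.invRev v) (S.reducedWord g)
  rw [FreeGroup.invRev_invRev] at h
  rw [S.reducedWord_inv, h]
  rfl

theorem countSubword_reducedWord_eq_zero (S : FreeGroupBasis ι F) {v : List (ι × Bool)}
    (hv : ¬ FreeGroup.IsReduced v) (g : F) : countSubword v (S.reducedWord g) = 0 :=
  countSubword_eq_zero_of_not_infix fun h => hv ((S.isReduced_reducedWord g).infix h)

/-- The odd part of a weighted subword count is, up to a bounded error, in the span. Non-reduced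
words do not occur in reduced words and contribute nothing. -/
theorem exists_mem_hocSpan_bddEquiv (S : FreeGroupBasis ι F) (s : Finset (List (ι × Bool)))
    (c : List (ι × Bool) → ℝ) : ∃ β ∈ hocSpan S, BddEquiv (β : F → ℝ) fun g =>
      ∑ v ∈ s, c v * countSubword v (S.reducedWord g) -
        ∑ v ∈ s, c v * countSubword v (S.reducedWord g⁻¹) := by
  classical
  induction s using Finset.induction_on with
  | empty => exact ⟨0, zero_mem _, 0, fun g => by simp⟩
  | insert v s hv ih =>
    obtain ⟨β, hβ, C, hC⟩ := ih
    by_cases hred : FreeGroup.IsReduced v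
    · obtain ⟨C', hC'⟩ := bddEquiv_homogenization (countingQuasimorphism S v)
      refine ⟨c v • homogenization (countingQuasimorphism S v) + β,
        add_mem (Submodule.smul_mem _ _ (Submodule.subset_span ⟨v, hred, rfl⟩)) hβ,
        |c v| * C' + C, fun g => ?_⟩
      have h1 := hC g
      have h2 := mul_le_mul_of_nonneg_left (hC' g) (abs_nonneg (c v))
      rw [← abs_mul] at h2
      have h3 : (countingQuasimorphism S v : F → ℝ) g =
          countSubword v (S.reducedWord g) - countSubword v (S.reducedWord g⁻¹) := by
        have := congrArg (Int.cast : ℤ → ℝ) (countingFun_eq S v g)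
        push_cast at this
        exact this
      rw [h3] at h2
      beta_reduce at h1 ⊢
      rw [Finset.sum_insert hv, Finset.sum_insert hv]
      simp only [Submodule.coe_add, Submodule.coe_smul, Pi.add_apply, Pi.smul_apply, smul_eq_mul]
      rw [abs_le] at *
      constructor <;> linarith [h1.1, h1.2, h2.1, h2.2]
    · refine ⟨β, hβ, C, fun g => ?_⟩
      beta_reduce
      rw [Finset.sum_insert hv, Finset.sum_insert hv, countSubword_reducedWord_eq_zero S hred,
        countSubword_reducedWord_eq_zero S hred]
      simpa using hC g

/-- A homogeneous quasimorphism at bounded distance from a window sum lies in the span of the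
counting quasimorphisms, since it is odd and the odd part of `countSubword v` is half of the
counting quasimorphism of `v`. -/
theorem mem_hocSpan_of_bddEquiv_windowSum [Finite ι] (S : FreeGroupBasis ι F)
    {α : homogeneousQuasimorphisms F} {M : ℕ} {θ : List (ι × Bool) → ℝ}
    (h : BddEquiv (α : F → ℝ) fun g => windowSum M θ (S.reducedWord g)) : α ∈ hocSpan S := by
  obtain ⟨β, hβ, C, hC⟩ := exists_mem_hocSpan_bddEquiv S (wordsOfLength _ M) θ
  obtain ⟨C', hC'⟩ := h
  suffices α = (2⁻¹ : ℝ) • β from this ▸ Submodule.smul_mem _ _ hβ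
  refine Subtype.ext (BddEquiv.eq_of_homogeneous α.2.2 ((2⁻¹ : ℝ) • β).2.2
    ⟨C' + C / 2, fun g => ?_⟩)
  have h1 := hC g
  have h2 := hC' g
  have h3 := hC' g⁻¹
  rw [homogeneous_inv α.2.1 α.2.2] at h3
  simp only [windowSum] at h2 h3
  simp only [Submodule.coe_smul, Pi.smul_apply, smul_eq_mul]
  rw [abs_le] at *
  constructor <;> linarith [h1.1, h1.2, h2.1, h2.2, h3.1, h3.2]

/-! ### Independence of the basis -/

/-- Counting quasimorphisms over `T` are local functions of the `S`-reduced word. -/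
theorem exists_bddEquiv_countingFun_windowSum [Finite ι] [Finite κ] (S : FreeGroupBasis ι F)
    (T : FreeGroupBasis κ F) (w : List (κ × Bool)) :
    ∃ (M : ℕ) (θ : List (ι × Bool) → ℝ), BddEquiv (fun g : F => (countingFun T w g : ℝ))
      fun g => windowSum M θ (S.reducedWord g) := by
  obtain ⟨L, hL⟩ := S.exists_bound_length_ofWord_singleton T
  obtain ⟨N, hN⟩ := S.exists_take_reducedWord_eq T (L + w.length + 1)
  obtain ⟨θ, C, hC⟩ := exists_windowSum_of_local FreeGroup.IsReduced
    (fun x l hl => hl.infix (List.suffix_cons x l).isInfix)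
    (fun l => (countingFun T w (S.ofWord l) : ℝ)) (N + 1) (by
      intro x l x' l' hl hl' hlen hlen' htake
      rw [List.take_succ_cons, List.take_succ_cons, List.cons.injEq] at htake
      obtain ⟨rfl, htake⟩ := htake
      simp only [List.length_cons, add_le_add_iff_right] at hlen hlen'
      have hloc := (hN l (hl.infix (List.suffix_cons x l).isInfix) hlen).trans
        (htake ▸ (hN l' (hl'.infix (List.suffix_cons x l').isInfix) hlen').symm)
      have key : ∀ v : List (κ × Bool), v.length = w.length →
          countSubword v (T.reducedWord (S.ofWord (x :: l))) +
              countSubword v (T.reducedWord (S.ofWord l')) =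
            countSubword v (T.reducedWord (S.ofWord (x :: l'))) +
              countSubword v (T.reducedWord (S.ofWord l)) := by
        intro v hv
        rw [← List.singleton_append, ← List.singleton_append (l := l'), S.ofWord_append,
          S.ofWord_append]
        refine T.countSubword_reducedWord_mul v _ _ _ ?_
        have := congrArg (List.take ((T.reducedWord (S.ofWord [x])).length + v.length + 1)) hloc
        rwa [List.take_take, List.take_take, min_eq_left] at this
        have := hL x
        omega
      have h1 := key w rfl
      have h2 := key (FreeGroup.invRev w) FreeGroup.invRev_length
      rw [← Int.cast_sub, ← Int.cast_sub, Int.cast_inj]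
      unfold countingFun countingOnWords
      omega)
  refine ⟨N + 1, θ, C, fun g => ?_⟩
  have := hC (S.reducedWord g) (S.isReduced_reducedWord g)
  rwa [S.ofWord_reducedWord] at this

/-- The half of basis independence that is proved directly; the other half is its symmetric copy. -/
theorem hocSpan_le [Finite ι] [Finite κ] (S : FreeGroupBasis ι F) (T : FreeGroupBasis κ F) :
    hocSpan T ≤ hocSpan S := by
  refine Submodule.span_le.mpr ?_
  rintro _ ⟨w, -, rfl⟩
  obtain ⟨M, θ, C, hC⟩ := exists_bddEquiv_countingFun_windowSum S T w
  obtain ⟨C', hC'⟩ := bddEquiv_homogenization (countingQuasimorphism T w)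
  refine mem_hocSpan_of_bddEquiv_windowSum S (M := M) (θ := θ) ⟨C + C', fun g => ?_⟩
  have h1 := hC g
  have h2 : |(countingFun T w g : ℝ) - _| ≤ C' := hC' g
  simp only at h1
  rw [abs_le] at *
  constructor <;> linarith [h1.1, h1.2, h2.1, h2.2]

theorem hocSpan_eq [Finite ι] [Finite κ] (S : FreeGroupBasis ι F) (T : FreeGroupBasis κ F) :
    hocSpan S = hocSpan T :=
  le_antisymm (hocSpan_le T S) (hocSpan_le S T)

theorem autPullback_homogenization (S : FreeGroupBasis ι F) (f : MulAut F)
    (w : List (ι × Bool)) :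
    autPullback f (homogenization (countingQuasimorphism S w)) =
      homogenization (countingQuasimorphism (S.map (f⁻¹ : MulAut F)) w) := by
  obtain ⟨C, hC⟩ := bddEquiv_homogenization (countingQuasimorphism S w)
  exact eq_homogenization ⟨C, fun g => hC (f g)⟩

theorem map_autPullback_hocSpan (S : FreeGroupBasis ι F) (f : MulAut F) :
    (hocSpan S).map (autPullback f) = hocSpan (S.map (f⁻¹ : MulAut F)) := by
  rw [hocSpan, hocSpan, Submodule.map_span]
  congr 1
  ext β
  constructor
  · rintro ⟨_, ⟨w, hw, rfl⟩, rfl⟩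
    exact ⟨w, hw, autPullback_homogenization S f w⟩
  · rintro ⟨w, hw, rfl⟩
    exact ⟨_, ⟨w, hw, rfl⟩, autPullback_homogenization S f w⟩

theorem map_outPullback_hocSpan [Finite ι] (S : FreeGroupBasis ι F) (σ : OuterAut F) :
    (hocSpan S).map (outPullback σ).unop = hocSpan S := by
  induction σ using QuotientGroup.induction_on with
  | H f => exact (map_autPullback_hocSpan S f).trans (hocSpan_eq _ _)

/-! ### Density -/

/-- Approximation of a homogeneous quasimorphism `α` of defect `D` by elements of the span. Up to
normalization, the approximant `γ` is the sum of the homogenized counting quasimorphisms of the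
reduced words `v` of length `m + 1` with coefficients `α v`, that is, the homogenization of the odd
part of the sum of `α` over windows. -/
theorem exists_mem_hocSpan_abs_sub_le [Finite ι] (S : FreeGroupBasis ι F)
    {α : homogeneousQuasimorphisms F} {D : ℝ}
    (hD : ∀ g h : F, |(α : F → ℝ) (g * h) - (α : F → ℝ) g - (α : F → ℝ) h| ≤ D) (m : ℕ) :
    ∃ γ ∈ hocSpan S, ∀ g : F, |(γ : F → ℝ) g - (α : F → ℝ) g| ≤
      D * (S.reducedWord g).length / (m + 1) := by
  set ψ : List (ι × Bool) → ℝ := fun l => (α : F → ℝ) (S.ofWord l) with hψ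
  obtain ⟨β, hβ, C, hC⟩ := exists_mem_hocSpan_bddEquiv S (wordsOfLength _ (m + 1)) ψ
  obtain ⟨C', hC'⟩ := exists_abs_windowSum_sub_le (ψ := ψ) (D := D) (M := m + 1) (fun u v => by
    simpa only [hψ, S.ofWord_append] using hD (S.ofWord u) (S.ofWord v)) (Nat.succ_pos m)
  have hD0 : 0 ≤ D := (abs_nonneg _).trans (hD 1 1)
  have hm : (0 : ℝ) < m + 1 := by positivity
  have h1 : ∀ g : F, |(β : F → ℝ) g - 2 * (m + 1) * (α : F → ℝ) g| ≤
      2 * D * (S.reducedWord g).length + (C + 2 * C') := by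
    intro g
    have h1 := hC g
    have h2 := hC' (S.reducedWord g)
    have h3 := hC' (S.reducedWord g⁻¹)
    simp only [hψ, S.ofWord_reducedWord] at h2 h3
    rw [homogeneous_inv α.2.1 α.2.2, S.length_reducedWord_inv] at h3
    simp only [windowSum] at h2 h3
    push_cast at h2 h3
    simp only [hψ] at h1
    rw [abs_le] at *
    constructor <;> linarith [h1.1, h1.2, h2.1, h2.2, h3.1, h3.2]
  have h2 : ∀ g : F, |(β : F → ℝ) g - 2 * (m + 1) * (α : F → ℝ) g| ≤
      2 * D * (S.reducedWord g).length := by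
    -- By homogeneity, evaluation on powers of `g` removes the additive constant.
    refine fun g => le_of_forall_nat_mul_le_add (C := C + 2 * C') fun n => ?_
    have h3 := h1 (g ^ n)
    rw [β.2.2, α.2.2] at h3
    have h4 : (n : ℝ) * |(β : F → ℝ) g - 2 * (m + 1) * (α : F → ℝ) g| =
        |n * (β : F → ℝ) g - 2 * (m + 1) * (n * (α : F → ℝ) g)| := by
      rw [← Nat.abs_cast n, ← abs_mul, Nat.abs_cast]
      congr 1
      ring
    have h5 : ((S.reducedWord (g ^ n)).length : ℝ) ≤ n * (S.reducedWord g).length := by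
      exact_mod_cast S.length_reducedWord_pow_le g n
    have h6 := mul_le_mul_of_nonneg_left h5 (show 0 ≤ 2 * D by positivity)
    rw [h4]
    linarith
  refine ⟨(2 * (m + 1 : ℝ))⁻¹ • β, Submodule.smul_mem _ _ hβ, fun g => ?_⟩
  have h3 : (((2 * (m + 1 : ℝ))⁻¹ • β : homogeneousQuasimorphisms F) : F → ℝ) g -
      (α : F → ℝ) g = ((β : F → ℝ) g - 2 * (m + 1) * (α : F → ℝ) g) / (2 * (m + 1)) := by
    simp only [Submodule.coe_smul, Pi.smul_apply, smul_eq_mul]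
    field_simp
  rw [h3, abs_div, abs_of_pos (show (0 : ℝ) < 2 * (m + 1) by positivity), div_le_div_iff₀
    (by positivity) hm]
  have := mul_le_mul_of_nonneg_right (h2 g) hm.le
  linarith

theorem dense_hocSpan [Finite ι] (S : FreeGroupBasis ι F) :
    Dense (hocSpan S : Set (homogeneousQuasimorphisms F)) := by
  intro α
  obtain ⟨D, hD⟩ := id α.2.1
  choose γ hγ hγα using exists_mem_hocSpan_abs_sub_le S hD
  refine mem_closure_of_tendsto (f := γ) (b := atTop) ?_ (Eventually.of_forall hγ)
  refine tendsto_subtype_rng.mpr (tendsto_pi_nhds.mpr fun g => ?_)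
  refine tendsto_iff_norm_sub_tendsto_zero.mpr
    (squeeze_zero (fun _ => norm_nonneg _) (fun m => hγα m g) ?_)
  have h := (tendsto_const_div_atTop_nhds_zero_nat (D * (S.reducedWord g).length)).comp
    (tendsto_add_atTop_nat 1)
  refine h.congr fun m => ?_
  simp

/-! ### Dimension -/

theorem rank_hocSpan_le [Finite ι] (S : FreeGroupBasis ι F) :
    Module.rank ℝ (hocSpan S) ≤ Cardinal.aleph0 := by
  refine (rank_span_le _).trans (Cardinal.le_aleph0_iff_set_countable.mpr ?_)
  refine (Set.countable_range fun w => homogenization (countingQuasimorphism S w)).mono ?_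
  rintro _ ⟨w, -, rfl⟩
  exact ⟨w, rfl⟩

end Span

section Independence

variable {A : Type*} {a b : A}

/-- The occurrences of `a bⁿ a` in a concatenation of copies of `a bᵐ` require `n = m`, and a
following copy to provide the last letter `a`. -/
theorem replicate_append_prefix_iff (hab : a ≠ b) {r : List A} (hr : ∀ x ∈ r.head?, x = a)
    (n m : ℕ) :
    List.replicate n b ++ [a] <+: List.replicate m b ++ r ↔ n = m ∧ r ≠ [] := by
  induction n generalizing m with
  | zero =>
    cases m with
    | zero => cases r <;> simp_all
    | succ m => simp [List.replicate_succ, hab]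
  | succ n ih =>
    cases m with
    | zero =>
      cases r with
      | nil => simp
      | cons x r =>
        have : x = a := hr x (by simp)
        simp [List.replicate_succ, this, hab.symm]
    | succ m =>
      simp only [List.replicate_succ, List.cons_append, List.cons_prefix_cons, true_and]
      rw [ih]
      simp

theorem countSubword_replicate_append (hab : a ≠ b) (w l : List A) (m : ℕ) :
    countSubword (a :: w) (List.replicate m b ++ l) = countSubword (a :: w) l := by
  classical
  induction m with
  | zero => simp
  | succ m ih => simp [List.replicate_succ, countSubword_cons, hab, ih]

theorem countSubword_flatten_replicate (hab : a ≠ b) (n m k : ℕ) :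
    countSubword (a :: (List.replicate n b ++ [a]))
      (List.replicate (k + 1) (a :: List.replicate m b)).flatten = if n = m then k else 0 := by
  classical
  have hhead : ∀ k : ℕ, ∀ x ∈ (List.replicate k (a :: List.replicate m b)).flatten.head?,
      x = a := by
    intro k
    cases k <;> simp [List.replicate_succ, eq_comm]
  have hstep : ∀ k : ℕ, countSubword (a :: (List.replicate n b ++ [a]))
      (List.replicate (k + 1) (a :: List.replicate m b)).flatten =
        (if n = m ∧ (List.replicate k (a :: List.replicate m b)).flatten ≠ [] then 1 else 0) +
          countSubword (a :: (List.replicate n b ++ [a]))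
            (List.replicate k (a :: List.replicate m b)).flatten := by
    intro k
    rw [List.replicate_succ, List.flatten_cons, List.cons_append, countSubword_cons,
      countSubword_replicate_append hab]
    simp only [List.cons_prefix_cons, true_and, replicate_append_prefix_iff hab (hhead k)]
  rw [hstep]
  induction k with
  | zero => simp [countSubword_nil]
  | succ k ih =>
    rw [hstep, ih]
    simp only [List.replicate_succ, List.flatten_cons, List.cons_append, ne_eq, reduceCtorEq,
      not_false_eq_true, and_true]
    split_ifs <;> omega

end Independence

section Rank

variable {ι F : Type*} [Group F]

theorem isReduced_of_forall_snd {l : List (ι × Bool)} (h : ∀ x ∈ l, x.2 = true) :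
    FreeGroup.IsReduced l :=
  List.Pairwise.isChain (R := fun x y : ι × Bool => x.1 = y.1 → x.2 = y.2)
    (List.pairwise_of_forall_mem_list fun x hx y hy _ => (h x hx).trans (h y hy).symm)

theorem countSubword_invRev_eq_zero {w l : List (ι × Bool)} (hw : ∃ x ∈ w, x.2 = true)
    (hl : ∀ x ∈ l, x.2 = true) : countSubword (FreeGroup.invRev w) l = 0 := by
  refine countSubword_eq_zero_of_not_infix fun h => ?_
  obtain ⟨x, hx, hx2⟩ := hw
  have := hl (x.1, !x.2) (h.subset (by
    rw [FreeGroup.invRev, List.mem_reverse]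
    exact List.mem_map_of_mem hx))
  simp [hx2] at this

theorem homogenization_countingQuasimorphism_apply (S : FreeGroupBasis ι F) {i j : ι}
    (hij : i ≠ j) (n m : ℕ) :
    (homogenization (countingQuasimorphism S
      ((i, true) :: (List.replicate n (j, true) ++ [(i, true)]))) : F → ℝ)
      (S.ofWord ((i, true) :: List.replicate m (j, true))) = if n = m then 1 else 0 := by
  set w : List (ι × Bool) := (i, true) :: (List.replicate n (j, true) ++ [(i, true)]) with hw
  set u : List (ι × Bool) := (i, true) :: List.replicate m (j, true) with hu
  have hu' : ∀ x ∈ u, x.2 = true := by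
    intro x hx
    rw [hu, List.mem_cons, List.mem_replicate] at hx
    rcases hx with rfl | ⟨-, rfl⟩ <;> rfl
  have hpow : ∀ k : ℕ, S.ofWord u ^ k = S.ofWord (List.replicate k u).flatten := by
    intro k
    induction k with
    | zero => simp [FreeGroupBasis.ofWord, ← FreeGroup.one_eq_mk]
    | succ k ih => rw [pow_succ', ih, List.replicate_succ, List.flatten_cons, S.ofWord_append]
  have hval : ∀ k : ℕ, (countingFun S w (S.ofWord u ^ (k + 1)) : ℝ) =
      k * if n = m then 1 else 0 := by
    intro k
    have hpos : ∀ x ∈ (List.replicate (k + 1) u).flatten, x.2 = true := by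
      intro x hx
      obtain ⟨l, hl, hx⟩ := List.mem_flatten.mp hx
      rw [List.eq_of_mem_replicate hl] at hx
      exact hu' x hx
    rw [countingFun, hpow, S.reducedWord_ofWord (isReduced_of_forall_snd hpos), countingOnWords,
      countSubword_invRev_eq_zero ⟨(i, true), by simp [hw], rfl⟩ hpos, hw, hu,
      countSubword_flatten_replicate (by simpa using hij)]
    split_ifs <;> simp
  obtain ⟨C, hC⟩ := bddEquiv_homogenization (countingQuasimorphism S w)
  set α := homogenization (countingQuasimorphism S w)
  set δ : ℝ := if n = m then 1 else 0 with hδ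
  have hC0 : 0 ≤ C := (abs_nonneg _).trans (hC 1)
  have hδ0 : 0 ≤ δ := by rw [hδ]; split_ifs <;> norm_num
  refine sub_eq_zero.mp (eq_zero_of_forall_nat_mul_le (C := C + δ) fun k => ?_)
  cases k with
  | zero => simpa using add_nonneg hC0 hδ0
  | succ k =>
    have h : |(countingFun S w (S.ofWord u ^ (k + 1)) : ℝ) - _| ≤ C := hC (S.ofWord u ^ (k + 1))
    rw [hval, α.2.2] at h
    rw [← Nat.abs_cast (k + 1), ← abs_mul, mul_sub]
    push_cast at h ⊢
    rw [abs_le] at *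
    constructor <;> linarith [h.1, h.2]

theorem aleph0_le_rank_hocSpan (S : FreeGroupBasis ι F) {i j : ι} (hij : i ≠ j) :
    Cardinal.aleph0 ≤ Module.rank ℝ (hocSpan S) := by
  let w : ℕ → List (ι × Bool) := fun n =>
    (i, true) :: (List.replicate n (j, true) ++ [(i, true)])
  have hw : ∀ n, FreeGroup.IsReduced (w n) := fun n => isReduced_of_forall_snd (by
    intro x hx
    simp only [w, List.mem_cons, List.mem_append, List.mem_replicate, List.not_mem_nil,
      or_false] at hx
    rcases hx with rfl | ⟨-, rfl⟩ | rfl <;> rfl)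
  let β : ℕ → hocSpan S := fun n =>
    ⟨homogenization (countingQuasimorphism S (w n)), Submodule.subset_span ⟨w n, hw n, rfl⟩⟩
  have hli : LinearIndependent ℝ fun n g =>
      ((β n : homogeneousQuasimorphisms F) : F → ℝ) g := by
    refine linearIndependent_iff'.mpr fun s c hc m hm => ?_
    have h := congrFun hc (S.ofWord ((i, true) :: List.replicate m (j, true)))
    simp only [Finset.sum_apply, Pi.smul_apply, Pi.zero_apply, smul_eq_mul, β, w,
      homogenization_countingQuasimorphism_apply S hij] at h
    simpa [hm] using h
  have hli : LinearIndependent ℝ β :=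
    LinearIndependent.of_comp ((homogeneousQuasimorphisms F).subtype ∘ₗ (hocSpan S).subtype) hli
  have := hli.cardinal_lift_le_rank
  simpa using this

end Rank

theorem theorem2 {F : Type*} [Group F] [IsFreeGroup F] [Group.FG F]
    (hF : ∃ a b : F, a * b ≠ b * a) :
    (∀ {ι : Type*} (S : FreeGroupBasis ι F) (σ : OuterAut F),
      (hocSpan S).map (outPullback σ).unop = hocSpan S) ∧
    (∀ {ι κ : Type*} (S : FreeGroupBasis ι F) (T : FreeGroupBasis κ F),
      hocSpan S = hocSpan T) ∧
    (∀ {ι : Type*} (S : FreeGroupBasis ι F),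
      Dense (hocSpan S : Set (homogeneousQuasimorphisms F))) ∧
    (∀ {ι : Type*} (S : FreeGroupBasis ι F),
      Module.rank ℝ (hocSpan S) = Cardinal.aleph0) := by
  refine ⟨fun S σ => ?_, fun S T => ?_, fun S => ?_, fun S => ?_⟩
  · have := S.finite_of_fg
    exact map_outPullback_hocSpan S σ
  · have := S.finite_of_fg
    have := T.finite_of_fg
    exact hocSpan_eq S T
  · have := S.finite_of_fg
    exact dense_hocSpan S
  · have := S.finite_of_fg
    obtain ⟨i, j, hij⟩ := S.exists_ne_of_not_comm hF
    exact le_antisymm (rank_hocSpan_le S) (aleph0_le_rank_hocSpan S hij)
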